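/- Let $\mathbf{CS}$ be the pseudovariety of all finite completely simple semigroups. For a finite nonempty set (alphabet) $A$, let $\overline{\Omega}_A\mathbf{CS}$ be the free pro-$\mathbf{CS}$ semigroup on $A$, that is, the inverse limit of all $A$-generated members of $\mathbf{CS}$, with the inverse limit topology (finite semigroups being discrete). A $\mathbf{CS}$-pseudoidentity is a formal equality $u=v$ with $u,v\in\overline{\Omega}_A\mathbf{CS}$ for some such $A$; it holds in $T\in\mathbf{CS}$ if $\varphi(u)=\varphi(v)$ for every continuous homomorphism $\varphi:\overline{\Omega}_A\mathbf{CS}\to T$. For a set $\Sigma$ of $\mathbf{CS}$-pseudoidentities, let $[\![\Sigma]\!]$ be the class of all $T\in\mathbf{CS}$ in which all members of $\Sigma$ hold. For each $A$, define by transfinite recursion subsets $\Sigma_\alpha$ of $\overline{\Omega}_A\mathbf{CS}\times\overline{\Omega}_A\mathbf{CS}$ as follows: (i) $\Sigma_0$ consists of all pairs $(w,w)$ and of all pairs $\bigl(t(\varphi(u),w_1,\ldots,w_n),\,t(\varphi(v),w_1,\ldots,w_n)\bigr)$ such that $u=v$ or $v=u$ belongs to $\Sigma$, with $u,v\in\overline{\Omega}_B\mathbf{CS}$,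 $\varphi:\overline{\Omega}_B\mathbf{CS}\to\overline{\Omega}_A\mathbf{CS}$ is a continuous homomorphism, $t$ is a term in the language of semigroups, $n\ge 0$, and $w_1,\ldots,w_n\in\overline{\Omega}_A\mathbf{CS}$; (ii) $\Sigma_{2\alpha+1}$ is the transitive closure of $\Sigma_{2\alpha}$; (iii) $\Sigma_{2\alpha+2}$ is the topological closure of $\Sigma_{2\alpha+1}$ in $\overline{\Omega}_A\mathbf{CS}\times\overline{\Omega}_A\mathbf{CS}$; (iv) $\Sigma_\alpha=\bigcup_{\beta<\alpha}\Sigma_\beta$ if $\alpha$ is a limit ordinal. A pseudoidentity $u=v$ with $u,v\in\overline{\Omega}_A\mathbf{CS}$ is provable from $\Sigma$ if $(u,v)\in\bigcup_\alpha\Sigma_\alpha$, the union being over all ordinals $\alpha$. Theorem. The pseudovariety $\mathbf{CS}$ is strong: for every set $\Sigma$ of $\mathbf{CS}$-pseudoidentities, every $\mathbf{CS}$-pseudoidentity that holds in all members of $[\![\Sigma]\!]$ is provable from $\Sigma$. -/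

import Mathlib

open Topology

/-! ### Pseudovarieties of semigroups -/

/-- A pseudovariety of semigroups: a nonempty class of finite (nonempty) semigroups closed under
homomorphic images, subsemigroups and finite direct products. -/
structure SemigroupPseudovariety where
  /-- Membership of a semigroup in the class. -/
  Mem : ∀ (S : Type) [Semigroup S], Prop
  finite : ∀ (S : Type) [Semigroup S], Mem S → Finite S
  nonempty : ∀ (S : Type) [Semigroup S], Mem S → Nonempty S
  image : ∀ (S T : Type) [Semigroup S] [Semigroup T] (f : S →ₙ* T),
    Function.Surjective f → Mem S → Mem T
  sub : ∀ (S : Type) [Semigroup S] (T : Subsemigroup S), Nonempty T → Mem S → Mem T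
  prod : ∀ (ι : Type) [Finite ι] (S : ι → Type) [∀ i, Semigroup (S i)],
    (∀ i, Mem (S i)) → Mem (∀ i, S i)

/-! ### The free pro-`U` semigroup on an alphabet -/

/-- The finite quotients of the free semigroup on `A` that lie in `U`, that is, the `A`-generated
members of `U`, given by the corresponding congruences. -/
def SemigroupPseudovariety.Quot (U : SemigroupPseudovariety) (A : Type) : Type :=
  {c : Con (FreeSemigroup A) // U.Mem c.Quotient}

/-- The inverse limit of the `A`-generated members of `U`, as a subsemigroup of their product:
the families compatible with the natural projections `c.Quotient → d.Quotient` for `c ≤ d`. -/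
def SemigroupPseudovariety.limit (U : SemigroupPseudovariety) (A : Type) :
    Subsemigroup (∀ c : U.Quot A, c.1.Quotient) where
  carrier := {x | ∀ c d : U.Quot A, c.1 ≤ d.1 → ∀ w : FreeSemigroup A,
    x c = (w : c.1.Quotient) → x d = (w : d.1.Quotient)}
  mul_mem' := by
    intro x y hx hy c d hcd w hw
    obtain ⟨a, ha⟩ := Quotient.exists_rep (x c)
    obtain ⟨b, hb⟩ := Quotient.exists_rep (y c)
    have ha' : x c = (a : c.1.Quotient) := ha.symm
    have hb' : y c = (b : c.1.Quotient) := hb.symm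
    have h1 := hx c d hcd a ha'
    have h2 := hy c d hcd b hb'
    have h3 : ((a * b : FreeSemigroup A) : c.1.Quotient) = (w : c.1.Quotient) := by
      rw [Con.coe_mul, ← ha', ← hb']; exact hw
    have h4 : ((a * b : FreeSemigroup A) : d.1.Quotient) = (w : d.1.Quotient) :=
      (Con.eq _).2 (hcd ((Con.eq _).1 h3))
    rw [← h4, Con.coe_mul, ← h1, ← h2]; rfl

/-- The free pro-`U` semigroup on the alphabet `A`; its elements are the `U`-pseudowords
over `A`. -/
def FreePro (U : SemigroupPseudovariety) (A : Type) : Type := U.limit A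

namespace FreePro

variable {U : SemigroupPseudovariety} {A : Type}

instance : Semigroup (FreePro U A) := inferInstanceAs (Semigroup (U.limit A))

/-- The projection to an `A`-generated member of `U`. -/
def proj (c : U.Quot A) : FreePro U A →ₙ* c.1.Quotient where
  toFun x := x.1 c
  map_mul' _ _ := rfl

/-- The inverse limit topology, the finite quotients being discrete. -/
instance : TopologicalSpace (FreePro U A) :=
  ⨅ c : U.Quot A, TopologicalSpace.induced (proj c) ⊥

/-- The finite pseudoword given by a word. -/
def ofWord : FreeSemigroup A →ₙ* FreePro U A where
  toFun w := ⟨fun c => (w : c.1.Quotient), fun _ _ hcd _ hw =>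
    (Con.eq _).2 (hcd ((Con.eq _).1 hw))⟩
  map_mul' _ _ := rfl

/-- The natural map from the alphabet. -/
def of (a : A) : FreePro U A := ofWord (FreeSemigroup.of a)

/-! The universal property of the free pro-`U` semigroup, for targets in `U`. -/

theorem _root_.SemigroupPseudovariety.mem_of_injective (U : SemigroupPseudovariety) {S T : Type}
    [Semigroup S] [Semigroup T] [Nonempty S] (f : S →ₙ* T) (hf : Function.Injective f)
    (hT : U.Mem T) : U.Mem S := by
  have : Nonempty f.srange := ⟨⟨f (Classical.arbitrary S), _, rfl⟩⟩
  have hex : ∀ t : f.srange, ∃ s, f s = t := fun t => t.2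
  choose g hg using hex
  refine U.image f.srange S ⟨g, fun x y => hf ?_⟩ (fun s => ⟨⟨f s, s, rfl⟩, hf (hg _)⟩)
    (U.sub T f.srange inferInstance hT)
  rw [map_mul, hg, hg, hg]; rfl

theorem continuous_proj (c : U.Quot A) : Continuous[_, ⊥] (proj (U := U) c) :=
  continuous_iff_le_induced.2 (iInf_le _ c)

theorem exists_ofWord_mem [Nonempty A] (x : FreePro U A) (V : Set (FreePro U A)) (hV : V ∈ 𝓝 x) :
    ∃ w, ofWord w ∈ V := by
  let _ : ∀ c : U.Quot A, TopologicalSpace c.1.Quotient := fun _ => ⊥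
  rw [nhds_iInf, Filter.mem_iInf] at hV
  obtain ⟨I, hI, W, hW, rfl⟩ := hV
  have := hI.to_subtype
  have : Nonempty (FreeSemigroup A) := ⟨.of (Classical.arbitrary A)⟩
  let l : FreeSemigroup A →ₙ* (∀ i : I, i.1.1.Quotient) :=
    ⟨fun w i => (w : i.1.1.Quotient), fun _ _ => rfl⟩
  have hrel : ∀ a b, Con.ker l a b ↔ l a = l b := fun a b => Iff.rfl
  have : Nonempty (Con.ker l).Quotient := ⟨((Classical.arbitrary _ : FreeSemigroup A) : _)⟩
  have hmem : U.Mem (Con.ker l).Quotient := by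
    refine U.mem_of_injective (T := ∀ i : I, i.1.1.Quotient)
      ⟨fun q => Con.liftOn q l fun a b h => h, ?_⟩ ?_ (U.prod I _ fun i => i.1.2)
    · rintro ⟨a⟩ ⟨b⟩; exact map_mul l a b
    · rintro ⟨a⟩ ⟨b⟩ h; exact Quot.sound h
  obtain ⟨w, hw⟩ := Quotient.exists_rep (x.1 ⟨Con.ker l, hmem⟩)
  refine ⟨w, Set.mem_iInter.2 fun i => ?_⟩
  have hWi := hW i
  rw [nhds_induced, Filter.mem_comap] at hWi
  obtain ⟨Z, hZ, hZW⟩ := hWi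
  have hxi : x.1 i.1 = (w : i.1.1.Quotient) :=
    x.2 ⟨Con.ker l, hmem⟩ i.1 (fun {a b} h => (Con.eq _).1 (congrFun ((hrel a b).1 h) i)) w hw.symm
  apply hZW
  change (w : i.1.1.Quotient) ∈ Z
  rw [← hxi]
  exact mem_of_mem_nhds hZ

theorem existsUnique_extension [Nonempty A] {T : Type} [Semigroup T] (hT : U.Mem T) (φ : A → T) :
    ∃! ψ : FreePro U A →ₙ* T, Continuous[_, ⊥] ψ ∧ ∀ a, ψ (of a) = φ a := by
  have hne : Nonempty (FreeSemigroup A) := ⟨.of (Classical.arbitrary A)⟩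
  let l : FreeSemigroup A →ₙ* T := FreeSemigroup.lift φ
  have : Nonempty (Con.ker l).Quotient := ⟨((Classical.arbitrary _ : FreeSemigroup A) : _)⟩
  let k : (Con.ker l).Quotient →ₙ* T := ⟨fun q => Con.liftOn q l fun a b h => h, by
    rintro ⟨a⟩ ⟨b⟩; exact map_mul l a b⟩
  have hk : Function.Injective k := by rintro ⟨a⟩ ⟨b⟩ h; exact Quot.sound h
  let c : U.Quot A := ⟨Con.ker l, U.mem_of_injective k hk hT⟩
  refine ⟨k.comp (proj c), ⟨?_, fun a => ?_⟩, ?_⟩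
  · have hkc : Continuous[⊥, ⊥] k := continuous_bot
    have hcomp := @Continuous.comp _ _ _ _ ⊥ ⊥ (proj c) k hkc (continuous_proj c)
    exact hcomp
  · exact FreeSemigroup.lift_of φ a
  · rintro ψ ⟨hψ, hψφ⟩
    have hw : ∀ w, ψ (ofWord w) = k (proj c (ofWord w)) := by
      intro w
      have h1 : ψ.comp ofWord = l := FreeSemigroup.hom_ext (funext fun a => by
        simpa [l, of] using hψφ a)
      exact DFunLike.congr_fun h1 w
    refine MulHom.ext fun x => ?_
    have o1 : IsOpen (ψ ⁻¹' {ψ x}) := @Continuous.isOpen_preimage _ _ _ ⊥ _ hψ _ trivial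
    have o2 : IsOpen (proj c ⁻¹' {proj c x}) := @Continuous.isOpen_preimage _ _ _ ⊥ _ (continuous_proj c) _ trivial
    obtain ⟨w, hw1, hw2⟩ := exists_ofWord_mem x _ ((o1.inter o2).mem_nhds ⟨rfl, rfl⟩)
    have e1 : ψ (ofWord w) = ψ x := hw1
    have e2 : proj c (ofWord w) = proj c x := hw2
    change ψ x = k (proj c x)
    rw [← e1, ← e2, hw]

end FreePro

/-! ### Pseudoidentities and their models -/

/-- A `U`-pseudoidentity: a formal equality of two `U`-pseudowords over a finite alphabet. (There
are no constants, so that the alphabet has to be nonempty.) -/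
structure Pseudoidentity (U : SemigroupPseudovariety) where
  Alphabet : Type
  [finite : Finite Alphabet]
  [nonempty : Nonempty Alphabet]
  lhs : FreePro U Alphabet
  rhs : FreePro U Alphabet

/-- The pseudoidentity `u = v` holds in `T ∈ U`: for each `φ : A → T`, `u` and `v` have the same
image under the unique continuous homomorphism from the free pro-`U` semigroup to `T` (with the
discrete topology) extending `φ`; equivalently, they have the same image under every continuous
homomorphism. -/
def Pseudoidentity.HoldsIn {U : SemigroupPseudovariety} (e : Pseudoidentity U)
    (T : Type) [Semigroup T] : Prop :=
  ∀ φ : FreePro U e.Alphabet →ₙ* T, Continuous[_, ⊥] φ → φ e.lhs = φ e.rhs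

/-- `T` belongs to the class `⟦Γ⟧` of the members of `U` in which all pseudoidentities from `Γ`
hold. -/
def IsModel {U : SemigroupPseudovariety} (Γ : Set (Pseudoidentity U))
    (T : Type) [Semigroup T] : Prop :=
  U.Mem T ∧ ∀ e ∈ Γ, e.HoldsIn T

/-! ### The proof scheme -/

section ProofScheme

variable {U : SemigroupPseudovariety} (Γ : Set (Pseudoidentity U)) (A : Type)

/-- The initial step: all pairs `(t(φ(u), w₁, …, wₙ), t(φ(v), w₁, …, wₙ))` where `u = v` or `v = u`
is in `Γ`, `φ` is a continuous homomorphism, `t` is a term, and the `wᵢ` are pseudowords,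
together with all trivial pairs. (The trivial pairs are already there unless `Γ` is empty.) -/
def initialStep : Set (FreePro U A × FreePro U A) :=
  {p | p.1 = p.2 ∨
    ∃ e ∈ Γ, ∃ u v : FreePro U e.Alphabet,
      ((u = e.lhs ∧ v = e.rhs) ∨ (u = e.rhs ∧ v = e.lhs)) ∧
      ∃ φ : FreePro U e.Alphabet →ₙ* FreePro U A, Continuous φ ∧
      ∃ (n : ℕ) (t : FreeMagma (Fin (n + 1))) (w : Fin n → FreePro U A),
        p.1 = FreeMagma.lift (Fin.cons (φ u) w : Fin (n + 1) → FreePro U A) t ∧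
        p.2 = FreeMagma.lift (Fin.cons (φ v) w : Fin (n + 1) → FreePro U A) t}

/-- The transitive closure of a set of pairs. -/
def transClosure {X : Type} (R : Set (X × X)) : Set (X × X) :=
  {p | Relation.TransGen (fun x y => (x, y) ∈ R) p.1 p.2}

open Classical in
/-- The transfinite sequence of sets of pairs: start from `initialStep`, take the transitive
closure when passing from `2 * α` to `2 * α + 1`, the topological closure when passing from
`2 * α + 1` to `2 * α + 2`, and unions at limit ordinals. -/
noncomputable def proofStep (α : Ordinal.{0}) : Set (FreePro U A × FreePro U A) :=
  Ordinal.limitRecOn α (initialStep Γ A)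
    (fun β R => if ∃ γ, β = 2 * γ then transClosure R else closure R)
    (fun β _ R => ⋃ (γ : Ordinal.{0}) (h : γ < β), R γ h)

theorem proofStep_zero : proofStep Γ A 0 = initialStep Γ A := by
  simp [proofStep]

theorem proofStep_odd (α : Ordinal.{0}) :
    proofStep Γ A (2 * α + 1) = transClosure (proofStep Γ A (2 * α)) := by
  unfold proofStep
  rw [Ordinal.limitRecOn_add_one, if_pos ⟨α, rfl⟩]

theorem proofStep_even (α : Ordinal.{0}) :
    proofStep Γ A (2 * α + 2) = closure (proofStep Γ A (2 * α + 1)) := by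
  have h : ¬ ∃ γ : Ordinal.{0}, 2 * α + 1 = 2 * γ := by
    rintro ⟨γ, h⟩
    have h1 : (2 * α + 1) % 2 = 1 := by
      rw [Ordinal.mul_add_mod_self, Ordinal.mod_eq_of_lt one_lt_two]
    rw [h, Ordinal.mul_mod] at h1
    exact zero_ne_one h1
  have h2 : (2 * α + 2 : Ordinal.{0}) = 2 * α + 1 + 1 := by rw [add_assoc, one_add_one_eq_two]
  unfold proofStep
  rw [h2, Ordinal.limitRecOn_add_one, if_neg h]

theorem proofStep_limit (α : Ordinal.{0}) (hα : Order.IsSuccLimit α) :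
    proofStep Γ A α = ⋃ (β : Ordinal.{0}) (_ : β < α), proofStep Γ A β := by
  unfold proofStep
  rw [Ordinal.limitRecOn_limit _ _ _ _ hα]

/-- The set of all pairs of pseudowords over `A` that are provable from `Γ`. -/
noncomputable def provablePairs : Set (FreePro U A × FreePro U A) :=
  ⋃ α : Ordinal.{0}, proofStep Γ A α

end ProofScheme

/-- The pseudoidentity `e` is provable from `Γ`. -/
def Pseudoidentity.ProvableFrom {U : SemigroupPseudovariety} (e : Pseudoidentity U)
    (Γ : Set (Pseudoidentity U)) : Prop :=
  (e.lhs, e.rhs) ∈ provablePairs Γ e.Alphabet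

/-- The pseudovariety `U` is strong: for every set `Γ` of `U`-pseudoidentities, each
`U`-pseudoidentity that holds in all members of `⟦Γ⟧` is provable from `Γ`. -/
def SemigroupPseudovariety.IsStrong (U : SemigroupPseudovariety) : Prop :=
  ∀ (Γ : Set (Pseudoidentity U)) (e : Pseudoidentity U),
    (∀ (T : Type) [Semigroup T], IsModel Γ T → e.HoldsIn T) → e.ProvableFrom Γ

/-! ### Completely simple semigroups -/

/-- A completely simple semigroup: it has no proper (two-sided, nonempty) ideals, and it has a
primitive idempotent. -/
structure IsCompletelySimple (S : Type) [Semigroup S] : Prop where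
  simple : ∀ I : Set S, I.Nonempty → (∀ x ∈ I, ∀ s, s * x ∈ I ∧ x * s ∈ I) → I = Set.univ
  primitive : ∃ e : S, IsIdempotentElem e ∧
    ∀ f : S, IsIdempotentElem f → e * f = f → f * e = f → f = e

namespace IsCompletelySimple

theorem exists_iterate {X : Type} [Finite X] (f : X → X) :
    ∃ n, 0 < n ∧ ∀ x, f^[n] (f^[n] x) = f^[n] x := by
  obtain ⟨i, j, hij, h⟩ := Finite.exists_ne_map_eq_of_infinite (fun n : ℕ => f^[n])
  wlog hlt : i < j generalizing i j
  · exact this j i hij.symm h.symm (by omega)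
  obtain ⟨d, rfl⟩ : ∃ d, j = i + d := ⟨j - i, by omega⟩
  have hd : 0 < d := by omega
  have step : ∀ k m, i ≤ m → f^[m + k * d] = f^[m] := by
    intro k
    induction k with
    | zero => intro m _; simp
    | succ k ih =>
      intro m hm
      obtain ⟨r, rfl⟩ := Nat.exists_eq_add_of_le hm
      have e1 : i + r + (k + 1) * d = (r + k * d) + (i + d) := by ring
      have e2 : i + r + k * d = (r + k * d) + i := by ring
      rw [← ih _ hm, e1, e2, Function.iterate_add, Function.iterate_add f _ i]
      exact congrArg (fun g => f^[r + k * d] ∘ g) h.symm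
  refine ⟨(i + 1) * d, by positivity, fun x => ?_⟩
  rw [← Function.iterate_add_apply, step (i + 1) ((i + 1) * d) (by nlinarith)]

theorem periodic {S : Type} [Semigroup S] [Finite S] (hS : IsCompletelySimple S) (a b : S) :
    ∃ n, 0 < n ∧ (fun s => s * (b * a))^[n] a = a := by
  obtain ⟨n, hn, hf⟩ := exists_iterate (fun s : S => s * (b * a))
  set f : S → S := fun s => s * (b * a) with hfdef
  refine ⟨n, hn, ?_⟩
  have hmul : ∀ (m : ℕ) (x y : S), f^[m] (x * y) = x * f^[m] y := by
    intro m
    induction m with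
    | zero => intros; rfl
    | succ m ih =>
      intro x y
      rw [Function.iterate_succ_apply', Function.iterate_succ_apply', ih]
      simp [hfdef, mul_assoc]
  obtain ⟨c, hc⟩ : ∃ c, f^[n] a = c * a := by
    obtain ⟨m, rfl⟩ : ∃ m, n = m + 1 := ⟨n - 1, by omega⟩
    clear hn hf
    induction m with
    | zero => exact ⟨a * b, by simp [hfdef, mul_assoc]⟩
    | succ m ih =>
      obtain ⟨c, hc⟩ := ih
      refine ⟨c * (a * b), ?_⟩
      rw [Function.iterate_succ_apply', hc]
      simp [hfdef, mul_assoc]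
  have hI : {s : S | ∃ p q, s = p * f^[n] a * q} = Set.univ := by
    refine hS.simple _ ⟨a * f^[n] a * a, a, a, rfl⟩ ?_
    rintro x ⟨p, q, rfl⟩ s
    exact ⟨⟨s * p, q, by simp [mul_assoc]⟩, ⟨p, q * s, by simp [mul_assoc]⟩⟩
  obtain ⟨p, q, hpq⟩ : a ∈ {s : S | ∃ p q, s = p * f^[n] a * q} := hI ▸ Set.mem_univ a
  let L : S → S := fun s => p * c * s
  let R : S → S := fun s => s * q
  obtain ⟨k, hk, hR⟩ := exists_iterate R
  have hLR : Function.Commute R L := fun s => by simp [L, R, mul_assoc]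
  have hLf : Function.Commute L f := fun s => by simp [L, hfdef, mul_assoc]
  have hfix : R (L a) = a := by
    rw [hc] at hpq
    simpa [L, R, mul_assoc] using hpq.symm
  have hfixk : R^[k] (L^[k] a) = a := by
    have h1 : (R ∘ L)^[k] a = a := Function.iterate_fixed hfix k
    rwa [hLR.comp_iterate] at h1
  have hRa : R^[k] a = a := by
    conv_lhs => rw [← hfixk]
    rw [hR, hfixk]
  have hLa : L^[k] a = a := by
    have h1 := (hLR.iterate_iterate k k) a
    rw [hfixk, hRa] at h1
    exact h1.symm
  have hL1 : L a = f^[n] (p * a) := by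
    rw [hmul, hc]; simp [L, mul_assoc]
  obtain ⟨m, rfl⟩ : ∃ m, k = m + 1 := ⟨k - 1, by omega⟩
  have hrange : a = f^[n] (L^[m] (p * a)) := by
    rw [← (hLf.iterate_iterate m n) (p * a), ← hL1, ← Function.iterate_succ_apply, hLa]
  conv_lhs => rw [hrange]
  rw [hf, ← hrange]

theorem of_periodic {S : Type} [Semigroup S] [Finite S] [Nonempty S]
    (h : ∀ a b : S, ∃ n, 0 < n ∧ (fun s => s * (b * a))^[n] a = a) : IsCompletelySimple S := by
  -- `a` is a product with `b` among the factors
  have key : ∀ a b : S, ∃ p, a = p * (b * a) := by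
    intro a b
    obtain ⟨n, hn, hp⟩ := h a b
    obtain ⟨m, rfl⟩ : ∃ m, n = m + 1 := ⟨n - 1, by omega⟩
    rw [Function.iterate_succ_apply'] at hp
    exact ⟨_, hp.symm⟩
  refine ⟨?_, ?_⟩
  · rintro I ⟨b, hb⟩ hI
    refine Set.eq_univ_of_forall fun a => ?_
    obtain ⟨p, hp⟩ := key a b
    rw [hp]
    exact (hI _ (hI _ hb a).2 p).1
  · obtain ⟨e, he⟩ : ∃ e : S, IsIdempotentElem e := by
      let _ : TopologicalSpace S := ⊥
      have : DiscreteTopology S := ⟨rfl⟩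
      exact exists_idempotent_of_compact_t2_of_continuous_mul_left fun _ =>
        continuous_of_discreteTopology
    refine ⟨e, he, fun f hf h1 h2 => ?_⟩
    obtain ⟨p, hp⟩ := key e f
    rw [h2] at hp
    calc f = e * f := h1.symm
      _ = p * f * f := by rw [← hp]
      _ = p * f := by rw [mul_assoc, hf.eq]
      _ = e := hp.symm

theorem image {S T : Type} [Semigroup S] [Semigroup T] [Finite S] (f : S →ₙ* T)
    (hf : Function.Surjective f) (hS : IsCompletelySimple S) : IsCompletelySimple T := by
  have : Finite T := Finite.of_surjective f hf
  have : Nonempty T := let ⟨e, _⟩ := hS.primitive; ⟨f e⟩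
  refine of_periodic fun a b => ?_
  obtain ⟨a, rfl⟩ := hf a
  obtain ⟨b, rfl⟩ := hf b
  obtain ⟨n, hn, h⟩ := hS.periodic a b
  have hs : Function.Semiconj f (fun s => s * (b * a)) (fun s => s * (f b * f a)) :=
    fun s => by simp
  exact ⟨n, hn, by rw [← (hs.iterate_right n) a, h]⟩

theorem sub {S : Type} [Semigroup S] [Finite S] (T : Subsemigroup S) [Nonempty T]
    (hS : IsCompletelySimple S) : IsCompletelySimple T := by
  refine of_periodic fun a b => ?_
  obtain ⟨n, hn, h⟩ := hS.periodic (a : S) b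
  have hs : Function.Semiconj (Subtype.val : T → S) (fun s => s * (b * a))
    (fun s => s * ((b : S) * a)) := fun s => by simp
  exact ⟨n, hn, Subtype.ext (by rw [(hs.iterate_right n) a, h])⟩

theorem prod {ι : Type} [Finite ι] {S : ι → Type} [∀ i, Semigroup (S i)] [∀ i, Finite (S i)]
    (hS : ∀ i, IsCompletelySimple (S i)) : IsCompletelySimple (∀ i, S i) := by
  have : Nonempty (∀ i, S i) := ⟨fun i => (hS i).primitive.choose⟩
  have := Fintype.ofFinite ι
  refine of_periodic fun a b => ?_
  choose n hn h using fun i => (hS i).periodic (a i) (b i)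
  refine ⟨∏ i, n i, Finset.prod_pos fun i _ => hn i, funext fun i => ?_⟩
  have hs : Function.Semiconj (fun x : ∀ i, S i => x i) (fun s => s * (b * a))
    (fun s => s * (b i * a i)) := fun s => by simp
  refine ((hs.iterate_right _) a).trans ?_
  exact (show Function.IsPeriodicPt _ (n i) (a i) from h i).trans_dvd
    (Finset.dvd_prod_of_mem n (Finset.mem_univ i))

end IsCompletelySimple

/-- The pseudovariety of all finite completely simple semigroups. -/
def CS : SemigroupPseudovariety where
  Mem S _ := Finite S ∧ IsCompletelySimple S
  finite _ _ h := h.1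
  nonempty _ _ h := let ⟨e, _⟩ := h.2.primitive; ⟨e⟩
  image _ _ _ _ f hf h := by
    have := h.1
    exact ⟨Finite.of_surjective f hf, h.2.image f hf⟩
  sub _ _ T _ h := by
    have := h.1
    exact ⟨inferInstance, h.2.sub T⟩
  prod _ _ _ _ h := by
    have := fun i => (h i).1
    exact ⟨inferInstance, IsCompletelySimple.prod fun i => (h i).2⟩

/-! Provable equality is a closed congruence θ on the free pro-`CS` semigroup, and a finite quotient
of that semigroup lying in `CS` is a model of `Γ` as soon as its kernel is open and contains θ. So
if `u = v` is not provable, an open congruence containing θ, with quotient in `CS`, must be found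
that separates `u` from `v`. As θ is closed, some kernel κ of a projection to a finite quotient has
no element of the κ-class of `v` θ-related to `u`; κ may be shrunk until it determines first and
last letters.

The candidate is the relational product of θ and κ. It does not relate `u` to `v`, and it is a
congruence because θ and κ permute (`exists_proj_eq_of_con`). The reason is the term m(a,b,c) = a a
(ba)⁻¹ c a a⁻¹, with inverses taken in maximal subgroups: m(a,b,b) = a always, while m(b,b,c) = c
whenever `b` and `c` have the same first and the same last letter. If a θ b κ c, then d = m(a,b,c)
satisfies a κ d θ c. The first identity rests on `mul_mul_groupInverse`, the second on the two
lemmas `..._of_ends`, and θ respects the inverses because they are unique. -/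

/-- The projection onto the quotient by a congruence. -/
def Con.quotientHom {S : Type} [Semigroup S] (θ : Con S) : S →ₙ* θ.Quotient :=
  ⟨fun x => (x : θ.Quotient), fun _ _ => rfl⟩

theorem Con.quotientHom_eq {S : Type} [Semigroup S] (θ : Con S) {x y : S} :
    θ.quotientHom x = θ.quotientHom y ↔ θ x y := Con.eq θ

/-! ### Finite families of quotients and the topology of the free pro-`U` semigroup -/

namespace FreePro

variable {U : SemigroupPseudovariety} {A : Type}

theorem ext {x y : FreePro U A} (h : ∀ c, proj c x = proj c y) : x = y :=
  Subtype.ext (funext h)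

theorem exists_ofWord_proj (c : U.Quot A) (x : FreePro U A) :
    ∃ w : FreeSemigroup A, proj c x = (w : c.1.Quotient) :=
  let ⟨w, hw⟩ := Quotient.exists_rep (proj c x)
  ⟨w, hw.symm⟩

theorem proj_of_le {c d : U.Quot A} (h : c.1 ≤ d.1) {x : FreePro U A} {w : FreeSemigroup A}
    (hw : proj c x = (w : c.1.Quotient)) : proj d x = (w : d.1.Quotient) :=
  x.2 c d h w hw

theorem proj_eq_of_le {c d : U.Quot A} (h : c.1 ≤ d.1) {x y : FreePro U A}
    (hxy : proj c x = proj c y) : proj d x = proj d y := by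
  obtain ⟨w, hw⟩ := exists_ofWord_proj c x
  rw [proj_of_le h hw, proj_of_le h (hxy ▸ hw)]

/-- The `A`-generated member of `U` defined by a homomorphism from the free semigroup to a member
of `U`. -/
def kerQuot [Nonempty A] {T : Type} [Semigroup T] (hT : U.Mem T) (l : FreeSemigroup A →ₙ* T) :
    U.Quot A :=
  ⟨Con.ker l, by
    have : Nonempty (FreeSemigroup A) := ⟨.of (Classical.arbitrary A)⟩
    have : Nonempty (Con.ker l).Quotient := ⟨((Classical.arbitrary _ : FreeSemigroup A) : _)⟩
    refine U.mem_of_injective (T := T)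
      ⟨fun q => Con.liftOn q l fun a b h => h, ?_⟩ ?_ hT
    · rintro ⟨a⟩ ⟨b⟩; exact map_mul l a b
    · rintro ⟨a⟩ ⟨b⟩ h; exact Quot.sound h⟩

theorem kerQuot_iff [Nonempty A] {T : Type} [Semigroup T] (hT : U.Mem T)
    (l : FreeSemigroup A →ₙ* T) (a b : FreeSemigroup A) :
    (kerQuot hT l).1 a b ↔ l a = l b := Iff.rfl

/-- The kernel of the diagonal map into the product of the given quotients works, since `U` is
closed under finite products. -/
theorem exists_le_of_finite [Nonempty A] {I : Type} [Finite I] (c : I → U.Quot A) :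
    ∃ d : U.Quot A, ∀ i, d.1 ≤ (c i).1 := by
  let l : FreeSemigroup A →ₙ* (∀ i : I, (c i).1.Quotient) :=
    ⟨fun w i => (w : (c i).1.Quotient), fun _ _ => rfl⟩
  exact ⟨kerQuot (U.prod I _ fun i => (c i).2) l, fun i {a b} h =>
    (Con.eq _).1 (congrFun ((kerQuot_iff _ l a b).1 h) i)⟩

theorem exists_le_le [Nonempty A] (c d : U.Quot A) : ∃ e : U.Quot A, e.1 ≤ c.1 ∧ e.1 ≤ d.1 :=
  let ⟨e, he⟩ := exists_le_of_finite fun b : Bool => cond b c d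
  ⟨e, he true, he false⟩

/-- A basic neighbourhood constrains finitely many projections, and directedness replaces them by a
single one. -/
theorem exists_proj_class_subset [Nonempty A] {x : FreePro U A} {V : Set (FreePro U A)}
    (hV : V ∈ 𝓝 x) : ∃ c : U.Quot A, ∀ y, proj c y = proj c x → y ∈ V := by
  let _ : ∀ c : U.Quot A, TopologicalSpace c.1.Quotient := fun _ => ⊥
  rw [nhds_iInf, Filter.mem_iInf] at hV
  obtain ⟨I, hI, W, hW, rfl⟩ := hV
  have := hI.to_subtype
  obtain ⟨c, hc⟩ := exists_le_of_finite fun i : I => i.1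
  refine ⟨c, fun y hy => Set.mem_iInter.2 fun i => ?_⟩
  have hWi := hW i
  rw [nhds_induced, Filter.mem_comap] at hWi
  obtain ⟨Z, hZ, hZW⟩ := hWi
  apply hZW
  change proj i.1 y ∈ Z
  rw [proj_eq_of_le (hc i) hy]
  exact mem_of_mem_nhds hZ

theorem isOpen_proj_class (c : U.Quot A) (x : FreePro U A) :
    IsOpen {y : FreePro U A | proj c y = proj c x} :=
  @Continuous.isOpen_preimage _ _ _ ⊥ _ (continuous_proj c) {proj c x} trivial

theorem continuous_discrete_of_proj (c : U.Quot A) {T : Type} (q : FreePro U A → T)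
    (h : ∀ x y, proj c x = proj c y → q x = q y) : Continuous[_, ⊥] q := by
  let _ : TopologicalSpace T := ⊥
  refine continuous_def.2 fun s _ => isOpen_iff_mem_nhds.2 fun x hx => ?_
  refine Filter.mem_of_superset ((isOpen_proj_class c x).mem_nhds rfl) fun y hy => ?_
  change q y ∈ s
  rw [h y x hy]
  exact hx

theorem continuous_of_proj {X : Type} [TopologicalSpace X] (f : X → FreePro U A)
    (h : ∀ c, Continuous[_, ⊥] fun x => proj c (f x)) : Continuous f := by
  refine continuous_iInf_rng.2 fun c => ?_
  let _ : TopologicalSpace c.1.Quotient := ⊥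
  exact continuous_induced_rng.2 (h c)

theorem continuous_mul_left (w : FreePro U A) : Continuous fun x => w * x :=
  continuous_of_proj _ fun c => continuous_discrete_of_proj c _ fun x y h => by
    simp only [map_mul, h]

theorem continuous_mul_right (w : FreePro U A) : Continuous fun x => x * w :=
  continuous_of_proj _ fun c => continuous_discrete_of_proj c _ fun x y h => by
    simp only [map_mul, h]

/-- The extension is built coordinate by coordinate; uniqueness of extensions into each finite
quotient makes the coordinates compatible. -/
theorem exists_extension {B : Type} [Nonempty B] [Nonempty A] (x : B → FreePro U A) :
    ∃ ψ : FreePro U B →ₙ* FreePro U A, Continuous ψ ∧ ∀ b, ψ (of b) = x b := by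
  choose ψ hψ _ using fun c : U.Quot A => existsUnique_extension c.2 fun b => proj c (x b)
  have hcompat : ∀ z : FreePro U B, (fun c => ψ c z) ∈ U.limit A := by
    intro z c d hcd w hw
    let k : c.1.Quotient →ₙ* d.1.Quotient :=
      ⟨fun q => Con.liftOn q (fun a => (a : d.1.Quotient)) fun a b h => (Con.eq _).2 (hcd h), by
        rintro ⟨a⟩ ⟨b⟩; rfl⟩
    have hk : ∀ z, k (proj c z) = proj d z := fun z => by
      obtain ⟨w, hw⟩ := exists_ofWord_proj c z
      rw [hw, proj_of_le hcd hw]; rfl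
    have hcont : Continuous[_, ⊥] (k.comp (ψ c)) :=
      @Continuous.comp _ _ _ _ ⊥ ⊥ (ψ c) k continuous_bot (hψ c).1
    have heq : k.comp (ψ c) = ψ d := (existsUnique_extension d.2 fun b => proj d (x b)).unique
      ⟨hcont, fun b => by rw [MulHom.comp_apply, (hψ c).2, hk]⟩ (hψ d)
    change ψ d z = _
    rw [← heq, MulHom.comp_apply, show ψ c z = _ from hw]
    rfl
  let ψ' : FreePro U B →ₙ* FreePro U A :=
    ⟨fun z => ⟨fun c => ψ c z, hcompat z⟩, fun y z =>
      ext fun c => map_mul (ψ c) y z⟩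
  exact ⟨ψ', continuous_of_proj _ fun c => (hψ c).1, fun b => ext fun c => (hψ c).2 b⟩

end FreePro

/-! ### Provable pairs form a closed congruence -/

section ProvablePairs

variable {U : SemigroupPseudovariety} {Γ : Set (Pseudoidentity U)} {A : Type}

theorem subset_transClosure {X : Type} (R : Set (X × X)) : R ⊆ transClosure R :=
  fun _ h => Relation.TransGen.single h

theorem proofStep_add_one (α : Ordinal.{0}) :
    proofStep Γ A (α + 1) = transClosure (proofStep Γ A α) ∨
      proofStep Γ A (α + 1) = closure (proofStep Γ A α) := by
  by_cases h : ∃ γ, α = 2 * γ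
  · left; unfold proofStep; rw [Ordinal.limitRecOn_add_one, if_pos h]
  · right; unfold proofStep; rw [Ordinal.limitRecOn_add_one, if_neg h]

theorem proofStep_mono : Monotone (proofStep Γ A) := by
  intro α β
  induction β using Ordinal.limitRecOn with
  | zero => intro h; rw [nonpos_iff_eq_zero.1 h]
  | add_one β ih =>
    intro h
    rcases h.eq_or_lt with rfl | h
    · exact le_rfl
    · refine (ih (Order.lt_add_one_iff.1 h)).trans ?_
      rcases proofStep_add_one (Γ := Γ) (A := A) β with e | e <;> rw [e]
      · exact subset_transClosure _
      · exact subset_closure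
  | limit β hβ ih =>
    intro h
    rcases h.eq_or_lt with rfl | h
    · exact le_rfl
    · rw [proofStep_limit Γ A β hβ]
      exact Set.subset_biUnion_of_mem (u := fun γ => proofStep Γ A γ) h

/-- The proof steps preserve each continuous operation on pairs that acts componentwise, possibly
with an exchange of the components, if the initial step does. -/
theorem mapsTo_proofStep {f : FreePro U A × FreePro U A → FreePro U A × FreePro U A}
    (hf : Continuous f)
    (htrans : ∀ R, Set.MapsTo f R R → Set.MapsTo f (transClosure R) (transClosure R))
    (h0 : Set.MapsTo f (initialStep Γ A) (initialStep Γ A)) (α : Ordinal.{0}) :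
    Set.MapsTo f (proofStep Γ A α) (proofStep Γ A α) := by
  induction α using Ordinal.limitRecOn with
  | zero => rwa [proofStep_zero]
  | add_one α ih =>
    rcases proofStep_add_one (Γ := Γ) (A := A) α with e | e <;> rw [e]
    · exact htrans _ ih
    · exact ih.closure hf
  | limit α hα ih =>
    rw [proofStep_limit Γ A α hα]
    exact Set.mapsTo_iUnion₂_iUnion₂ ih

theorem mapsTo_provablePairs {f : FreePro U A × FreePro U A → FreePro U A × FreePro U A}
    (hf : Continuous f)
    (htrans : ∀ R, Set.MapsTo f R R → Set.MapsTo f (transClosure R) (transClosure R))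
    (h0 : Set.MapsTo f (initialStep Γ A) (initialStep Γ A)) :
    Set.MapsTo f (provablePairs Γ A) (provablePairs Γ A) :=
  Set.mapsTo_iUnion_iUnion fun α => mapsTo_proofStep hf htrans h0 α

theorem initialStep_subset_provablePairs : initialStep Γ A ⊆ provablePairs Γ A := by
  rw [← proofStep_zero]
  exact Set.subset_iUnion (proofStep Γ A) 0

/-- The initial step admits both `u = v` and `v = u`, and exchanging components is continuous and
compatible with transitive closure. -/
theorem provablePairs_symm {x y : FreePro U A} (h : (x, y) ∈ provablePairs Γ A) :
    (y, x) ∈ provablePairs Γ A := by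
  refine mapsTo_provablePairs (f := Prod.swap) continuous_swap ?_ ?_ h
  · intro R hR p hp
    have hp' : Relation.TransGen (fun x y => (x, y) ∈ R) p.1 p.2 := hp
    exact (Relation.transGen_swap.2 hp').lift id fun _ _ h => hR h
  · rintro p (hp | ⟨e, he, u, v, huv, φ, hφ, n, t, w, h1, h2⟩)
    · exact Or.inl hp.symm
    · exact Or.inr ⟨e, he, v, u, huv.symm.imp And.symm And.symm, φ, hφ, n, t, w, h2, h1⟩

theorem mapsTo_transClosure_prodMap {X : Type} (g : X → X) (R : Set (X × X))
    (hR : Set.MapsTo (Prod.map g g) R R) :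
    Set.MapsTo (Prod.map g g) (transClosure R) (transClosure R) :=
  fun p hp =>
    have hp' : Relation.TransGen (fun x y => (x, y) ∈ R) p.1 p.2 := hp
    hp'.lift g fun _ _ h => hR h

/-- Adding a parameter to a term does not change its values. -/
theorem lift_cons_snoc {S : Type} [Semigroup S] {n : ℕ} (u z : S) (w : Fin n → S)
    (t : FreeMagma (Fin (n + 1))) :
    FreeMagma.lift (Fin.cons u (Fin.snoc w z : Fin (n + 1) → S) : Fin (n + 2) → S)
      (FreeMagma.map Fin.castSucc t) = FreeMagma.lift (Fin.cons u w : Fin (n + 1) → S) t := by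
  induction t with
  | ih1 i =>
    rw [FreeMagma.map_of, FreeMagma.lift_of, FreeMagma.lift_of, Fin.cons_snoc_eq_snoc_cons,
      Fin.snoc_castSucc]
  | ih2 s t hs ht => rw [map_mul, map_mul, map_mul, hs, ht]

theorem lift_cons_snoc_last {S : Type} [Semigroup S] {n : ℕ} (u z : S) (w : Fin n → S) :
    FreeMagma.lift (Fin.cons u (Fin.snoc w z : Fin (n + 1) → S) : Fin (n + 2) → S)
      (FreeMagma.of (Fin.last (n + 1))) = z := by
  rw [FreeMagma.lift_of, Fin.cons_snoc_eq_snoc_cons, Fin.snoc_last]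

/-- The initial step absorbs the factor `z` as one further parameter of the term; translations are
continuous, so later steps inherit this. -/
theorem provablePairs_mul_left (z : FreePro U A) {x y : FreePro U A}
    (h : (x, y) ∈ provablePairs Γ A) : (z * x, z * y) ∈ provablePairs Γ A := by
  have hz := FreePro.continuous_mul_left z
  refine mapsTo_provablePairs (f := Prod.map (z * ·) (z * ·)) (hz.prodMap hz)
    (mapsTo_transClosure_prodMap _) ?_ h
  rintro p (hp | ⟨e, he, u, v, huv, φ, hφ, n, t, w, h1, h2⟩)
  · exact Or.inl (congrArg (z * ·) hp)
  · refine Or.inr ⟨e, he, u, v, huv, φ, hφ, n + 1,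
      .of (Fin.last (n + 1)) * FreeMagma.map Fin.castSucc t, Fin.snoc w z, ?_, ?_⟩
    · rw [map_mul, lift_cons_snoc, lift_cons_snoc_last, ← h1]; rfl
    · rw [map_mul, lift_cons_snoc, lift_cons_snoc_last, ← h2]; rfl

theorem provablePairs_mul_right (z : FreePro U A) {x y : FreePro U A}
    (h : (x, y) ∈ provablePairs Γ A) : (x * z, y * z) ∈ provablePairs Γ A := by
  have hz := FreePro.continuous_mul_right z
  refine mapsTo_provablePairs (f := Prod.map (· * z) (· * z)) (hz.prodMap hz)
    (mapsTo_transClosure_prodMap _) ?_ h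
  rintro p (hp | ⟨e, he, u, v, huv, φ, hφ, n, t, w, h1, h2⟩)
  · exact Or.inl (congrArg (· * z) hp)
  · refine Or.inr ⟨e, he, u, v, huv, φ, hφ, n + 1,
      FreeMagma.map Fin.castSucc t * .of (Fin.last (n + 1)), Fin.snoc w z, ?_, ?_⟩
    · rw [map_mul, lift_cons_snoc, lift_cons_snoc_last, ← h1]; rfl
    · rw [map_mul, lift_cons_snoc, lift_cons_snoc_last, ← h2]; rfl

variable (Γ A) in
-- Each provable pair appears at some stage, and since the pairs form a small set these stages have
-- a supremum.
theorem exists_proofStep_eq_provablePairs :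
    ∃ α : Ordinal.{0}, ∀ β, α ≤ β → proofStep Γ A β = provablePairs Γ A := by
  choose f hf using fun p : provablePairs Γ A => Set.mem_iUnion.1 p.2
  refine ⟨⨆ p, f p, fun β hβ => (Set.subset_iUnion (proofStep Γ A) β).antisymm fun p hp => ?_⟩
  exact proofStep_mono ((le_ciSup (Ordinal.bddAbove_of_small) ⟨p, hp⟩).trans hβ) (hf ⟨p, hp⟩)

theorem le_two_mul_ordinal (α : Ordinal.{0}) : α ≤ 2 * α :=
  Ordinal.le_mul_right α two_pos

variable (Γ A) in
-- Beyond stabilization there is still a stage that is a topological closure. Transitivity follows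
-- likewise from a later stage that is a transitive closure.
theorem isClosed_provablePairs : IsClosed (provablePairs Γ A) := by
  obtain ⟨α, hα⟩ := exists_proofStep_eq_provablePairs Γ A
  rw [← hα (2 * α + 2) ((le_two_mul_ordinal α).trans le_self_add), proofStep_even]
  exact isClosed_closure

theorem provablePairs_trans {x y z : FreePro U A} (hxy : (x, y) ∈ provablePairs Γ A)
    (hyz : (y, z) ∈ provablePairs Γ A) : (x, z) ∈ provablePairs Γ A := by
  obtain ⟨α, hα⟩ := exists_proofStep_eq_provablePairs Γ A
  rw [← hα (2 * α) (le_two_mul_ordinal α)] at hxy hyz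
  rw [← hα (2 * α + 1) ((le_two_mul_ordinal α).trans le_self_add), proofStep_odd]
  exact .tail (.single hxy) hyz

variable (Γ A) in
/-- The congruence of provable equality. -/
def provableCon : Con (FreePro U A) where
  r x y := (x, y) ∈ provablePairs Γ A
  iseqv := ⟨fun _ => initialStep_subset_provablePairs (Or.inl rfl), provablePairs_symm,
    provablePairs_trans⟩
  mul' h h' := provablePairs_trans (provablePairs_mul_right _ h) (provablePairs_mul_left _ h')

theorem provableCon_hom {e : Pseudoidentity U} (he : e ∈ Γ)
    (φ : FreePro U e.Alphabet →ₙ* FreePro U A) (hφ : Continuous φ) :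
    provableCon Γ A (φ e.lhs) (φ e.rhs) :=
  initialStep_subset_provablePairs (Or.inr ⟨e, he, e.lhs, e.rhs, Or.inl ⟨rfl, rfl⟩, φ, hφ, 0,
    .of 0, Fin.elim0, rfl, rfl⟩)

end ProvablePairs

/-! ### Inverses in subgroups -/

/-- `y` is the inverse of `x` in the maximal subgroup containing `x`. -/
structure IsGroupInverse {S : Type} [Semigroup S] (x y : S) : Prop where
  mul_mul : x * y * x = x
  inv_mul_inv : y * x * y = y
  comm : x * y = y * x

namespace IsGroupInverse

/-- Valid in every semigroup, so it also applies to quotients by congruences that need not be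
finite. -/
theorem unique {S : Type} [Semigroup S] {x y z : S} (hy : IsGroupInverse x y)
    (hz : IsGroupInverse x z) : y = z := by
  have h : x * y = x * z := by
    calc x * y = x * z * x * y := by rw [hz.mul_mul]
      _ = z * (x * (x * y)) := by rw [hz.comm]; simp only [mul_assoc]
      _ = z * (x * y * x) := by rw [mul_assoc x y, hy.comm]
      _ = x * z := by rw [hy.mul_mul, hz.comm]
  calc y = y * x * y := hy.inv_mul_inv.symm
    _ = z * x * y := by rw [← hy.comm, h, hz.comm]
    _ = z * x * z := by rw [mul_assoc, h, mul_assoc]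
    _ = z := hz.inv_mul_inv

theorem map {S T : Type} [Semigroup S] [Semigroup T] (f : S →ₙ* T) {x y : S}
    (h : IsGroupInverse x y) : IsGroupInverse (f x) (f y) :=
  ⟨by simp only [← map_mul, h.mul_mul], by simp only [← map_mul, h.inv_mul_inv],
    by simp only [← map_mul, h.comm]⟩

end IsGroupInverse

/-! ### Cancellation and inverses in finite completely simple semigroups -/

namespace IsCompletelySimple

variable {S : Type} [Semigroup S]

theorem iterate_mul_right (a b c : S) (m : ℕ) :
    (fun s => s * c)^[m] (a * b) = a * (fun s => s * c)^[m] b := by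
  induction m with
  | zero => rfl
  | succ m ih => rw [Function.iterate_succ_apply', Function.iterate_succ_apply', ih, mul_assoc]

variable [Finite S]

theorem exists_eq_mul_mul_right (hS : IsCompletelySimple S) (a p : S) :
    ∃ s, a = a * p * s := by
  obtain ⟨n, hn, h⟩ := hS.periodic a p
  obtain ⟨m, rfl⟩ : ∃ m, n = m + 1 := ⟨n - 1, by omega⟩
  -- Periodicity says a(pa)ⁿ = a with n > 0; the prefix `a * p` is split off.
  rw [Function.iterate_succ_apply, ← mul_assoc, iterate_mul_right] at h
  exact ⟨_, h.symm⟩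

theorem exists_eq_mul_mul_left (hS : IsCompletelySimple S) (a p : S) :
    ∃ s, a = s * (p * a) := by
  obtain ⟨n, hn, h⟩ := hS.periodic a p
  obtain ⟨m, rfl⟩ : ∃ m, n = m + 1 := ⟨n - 1, by omega⟩
  rw [Function.iterate_succ_apply'] at h
  exact ⟨_, h.symm⟩

theorem exists_isGroupInverse (hS : IsCompletelySimple S) (x : S) : ∃ y, IsGroupInverse x y := by
  -- `x = x * x * s = t * (x * x)`, and `t * x * s` is the inverse
  obtain ⟨s, hs⟩ := hS.exists_eq_mul_mul_right x x
  obtain ⟨t, ht⟩ := hS.exists_eq_mul_mul_left x x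
  have h : t * x = x * s := by
    calc t * x = t * (x * x * s) := by rw [← hs]
      _ = t * (x * x) * s := by simp only [mul_assoc]
      _ = x * s := by rw [← ht]
  have h1 : x * (t * x * s) = x * s := by
    rw [h, ← mul_assoc, ← mul_assoc, ← hs]
  have h2 : t * x * s * x = x * s := by
    rw [mul_assoc t, ← h, mul_assoc t, mul_assoc t, ← ht, h]
  have h3 : x * s * x = x := by rw [← h, mul_assoc, ← ht]
  exact ⟨t * x * s, by rw [h1, h3], by rw [h2, h, ← mul_assoc, ← mul_assoc, h3], by rw [h1, h2]⟩

/-- The idempotent `b * a * y` is a right identity on all left multiples of `b * a`, and `a` is one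
of them by complete simplicity. -/
theorem mul_mul_groupInverse (hS : IsCompletelySimple S) {a b y : S}
    (hy : IsGroupInverse (b * a) y) : a * (b * a * y) = a := by
  obtain ⟨s, hs⟩ := hS.exists_eq_mul_mul_left a b
  calc a * (b * a * y) = s * (b * a) * (b * a * y) := by rw [← hs]
    _ = s * (b * a * y * (b * a)) := by rw [mul_assoc s, mul_assoc (b * a) y, ← hy.comm]
    _ = a := by rw [hy.mul_mul, ← hs]

end IsCompletelySimple

/-! ### The first and the last letter of a pseudoword -/

/-- The rectangular band on `A × A`. -/
structure RectBand (A : Type) where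
  fst : A
  snd : A

namespace RectBand

variable {A : Type}

instance : Semigroup (RectBand A) where
  mul x y := ⟨x.fst, y.snd⟩
  mul_assoc _ _ _ := rfl

theorem fst_mul (x y : RectBand A) : (x * y).fst = x.fst := rfl

theorem snd_mul (x y : RectBand A) : (x * y).snd = y.snd := rfl

theorem mem_CS [Finite A] [Nonempty A] : CS.Mem (RectBand A) := by
  have : Finite (RectBand A) := Finite.of_injective (fun x => (x.fst, x.snd)) fun x y h => by
    cases x; cases y; simpa using h
  have : Nonempty (RectBand A) := ⟨⟨Classical.arbitrary A, Classical.arbitrary A⟩⟩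
  exact ⟨inferInstance, IsCompletelySimple.of_periodic fun _ _ => ⟨1, one_pos, rfl⟩⟩

/-- The first and the last letter of a word. -/
def ends : FreeSemigroup A →ₙ* RectBand A := FreeSemigroup.lift fun a => ⟨a, a⟩

theorem ends_of (a : A) : ends (.of a) = ⟨a, a⟩ := FreeSemigroup.lift_of _ _

theorem eq_of_fst_mul (w : FreeSemigroup A) :
    w = .of (ends w).fst ∨ ∃ p, w = .of (ends w).fst * p := by
  induction w using FreeSemigroup.recOnMul with
  | ih1 a => left; rw [ends_of]
  | ih2 a p _ _ => right; exact ⟨p, by rw [map_mul, fst_mul, ends_of]⟩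

theorem eq_mul_of_snd (w : FreeSemigroup A) :
    w = .of (ends w).snd ∨ ∃ p, w = p * .of (ends w).snd := by
  induction w using FreeSemigroup.recOnMul with
  | ih1 a => left; rw [ends_of]
  | ih2 a p _ h =>
    right
    rw [map_mul, snd_mul]
    rcases h with h | ⟨q, h⟩
    · exact ⟨.of a, by rw [← h]⟩
    · exact ⟨.of a * q, by rw [mul_assoc, ← h]⟩

end RectBand

/-! ### Inverses and end letters in the free pro-`CS` semigroup -/

namespace FreePro

variable {A : Type}

/-- Inverses are taken in each finite quotient; homomorphisms preserve them, so uniqueness makes the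
family compatible. -/
theorem exists_isGroupInverse (x : FreePro CS A) : ∃ y, IsGroupInverse x y := by
  choose y hy using fun c : CS.Quot A =>
    have := c.2.1
    c.2.2.exists_isGroupInverse (proj c x)
  refine ⟨⟨y, fun c d hcd w hw => ?_⟩, ext fun c => (hy c).mul_mul,
    ext fun c => (hy c).inv_mul_inv, ext fun c => (hy c).comm⟩
  obtain ⟨v, hv⟩ := exists_ofWord_proj c x
  have hc := hy c
  let k : c.1.Quotient →ₙ* d.1.Quotient :=
    ⟨fun q => Con.liftOn q (fun a => (a : d.1.Quotient)) fun a b h => (Con.eq _).2 (hcd h), by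
      rintro ⟨a⟩ ⟨b⟩; rfl⟩
  rw [hw, hv] at hc
  have hd := hy d
  rw [proj_of_le hcd hv] at hd
  exact hd.unique (hc.map k)

theorem mul_mul_groupInverse {a b y : FreePro CS A} (hy : IsGroupInverse (b * a) y) :
    a * (b * a * y) = a := ext fun c => by
  have := c.2.1
  have h := hy.map (proj c)
  rw [map_mul] at h
  simpa only [map_mul] using c.2.2.mul_mul_groupInverse h

/-- The quotient by ρ is a homomorphic image of the finite quotient given by κ. -/
theorem mem_CS_quotient_of_proj {ρ : Con (FreePro CS A)} {κ : CS.Quot A}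
    (h : ∀ x y, proj κ x = proj κ y → ρ x y) : CS.Mem ρ.Quotient := by
  let k : κ.1.Quotient →ₙ* ρ.Quotient :=
    ⟨fun q => Con.liftOn q (fun w => ((ofWord w : FreePro CS A) : ρ.Quotient))
      fun v w hvw => (Con.eq _).2 (h _ _ ((Con.eq _).2 hvw)), by rintro ⟨a⟩ ⟨b⟩; rfl⟩
  refine CS.image _ _ k ?_ κ.2
  rintro ⟨x⟩
  obtain ⟨w, hw⟩ := exists_ofWord_proj κ x
  exact ⟨w, (Con.eq _).2 (h _ _ (show proj κ (ofWord w) = proj κ x from hw.symm))⟩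

/-- The finite completely simple quotient that remembers the first and the last letter. -/
noncomputable def endsQuot (A : Type) [Finite A] [Nonempty A] : CS.Quot A :=
  kerQuot RectBand.mem_CS RectBand.ends

variable [Finite A] [Nonempty A]

/-- The idempotent `x * x'` fixes on the left every right multiple of `x`. In a finite completely
simple quotient the first letter of `x` is such a multiple, hence so is `y`, which starts with the
same letter. -/
theorem mul_groupInverse_mul_of_ends {x x' y : FreePro CS A} (hx : IsGroupInverse x x')
    (h : proj (endsQuot A) x = proj (endsQuot A) y) : x * x' * y = y := by
  refine ext fun c => ?_
  obtain ⟨d, hdc, hd⟩ := exists_le_le c (endsQuot A)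
  refine proj_eq_of_le hdc ?_
  have := d.2.1
  obtain ⟨v, hv⟩ := exists_ofWord_proj d x
  obtain ⟨w, hw⟩ := exists_ofWord_proj d y
  rw [proj_of_le hd hv, proj_of_le hd hw, Con.eq] at h
  have he : RectBand.ends v = RectBand.ends w := (kerQuot_iff _ _ _ _).1 h
  set a := (RectBand.ends v).fst with ha
  -- the first letter is a right multiple of `x`, and `y` of the first letter
  have hxa : (((FreeSemigroup.of a : FreeSemigroup A) : d.1.Quotient) = proj d x) ∨
      ∃ s, ((FreeSemigroup.of a : FreeSemigroup A) : d.1.Quotient) = proj d x * s := by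
    rw [hv]
    rcases RectBand.eq_of_fst_mul v with h | ⟨p, h⟩
    · left; rw [ha, ← h]
    · right
      obtain ⟨s, hs⟩ := d.2.2.exists_eq_mul_mul_right
        ((FreeSemigroup.of a : FreeSemigroup A) : d.1.Quotient) (p : d.1.Quotient)
      rw [← Con.coe_mul, ← h] at hs
      exact ⟨s, hs⟩
  have hfix : proj d x * proj d x' * (FreeSemigroup.of a : FreeSemigroup A) =
      ((FreeSemigroup.of a : FreeSemigroup A) : d.1.Quotient) := by
    have h1 := (hx.map (proj d)).mul_mul
    rcases hxa with e | ⟨s, e⟩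
    · rw [e, h1]
    · rw [e, ← mul_assoc, h1]
  rw [map_mul, map_mul, hw]
  rcases RectBand.eq_of_fst_mul w with e | ⟨p, e⟩
  · rw [← he, ← ha] at e
    rw [e, hfix]
  · rw [← he, ← ha] at e
    rw [e, Con.coe_mul, ← mul_assoc, hfix]

theorem mul_mul_groupInverse_of_ends {x x' y : FreePro CS A} (hx : IsGroupInverse x x')
    (h : proj (endsQuot A) x = proj (endsQuot A) y) : y * (x * x') = y := by
  refine ext fun c => ?_
  obtain ⟨d, hdc, hd⟩ := exists_le_le c (endsQuot A)
  refine proj_eq_of_le hdc ?_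
  have := d.2.1
  obtain ⟨v, hv⟩ := exists_ofWord_proj d x
  obtain ⟨w, hw⟩ := exists_ofWord_proj d y
  rw [proj_of_le hd hv, proj_of_le hd hw, Con.eq] at h
  have he : RectBand.ends v = RectBand.ends w := (kerQuot_iff _ _ _ _).1 h
  set a := (RectBand.ends v).snd with ha
  have hxa : (((FreeSemigroup.of a : FreeSemigroup A) : d.1.Quotient) = proj d x) ∨
      ∃ s, ((FreeSemigroup.of a : FreeSemigroup A) : d.1.Quotient) = s * proj d x := by
    rw [hv]
    rcases RectBand.eq_mul_of_snd v with h | ⟨p, h⟩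
    · left; rw [ha, ← h]
    · right
      obtain ⟨s, hs⟩ := d.2.2.exists_eq_mul_mul_left
        ((FreeSemigroup.of a : FreeSemigroup A) : d.1.Quotient) (p : d.1.Quotient)
      rw [← Con.coe_mul, ← h] at hs
      exact ⟨s, hs⟩
  have hfix : (FreeSemigroup.of a : FreeSemigroup A) * (proj d x * proj d x') =
      ((FreeSemigroup.of a : FreeSemigroup A) : d.1.Quotient) := by
    have h1 := (hx.map (proj d)).mul_mul
    rw [mul_assoc, ← (hx.map (proj d)).comm] at h1
    rcases hxa with e | ⟨s, e⟩
    · rw [e, h1]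
    · rw [e, mul_assoc, h1]
  rw [map_mul, map_mul, hw]
  rcases RectBand.eq_mul_of_snd w with e | ⟨p, e⟩
  · rw [← he, ← ha] at e
    rw [e, hfix]
  · rw [← he, ← ha] at e
    rw [e, Con.coe_mul, mul_assoc, hfix]

/-! ### Permutability and separation -/

/-- A congruence permutes with the kernels of the projections that determine the first and the last
letter. -/
theorem exists_proj_eq_of_con (θ : Con (FreePro CS A)) {κ : CS.Quot A}
    (hκ : κ.1 ≤ (endsQuot A).1) {a b c : FreePro CS A} (hab : θ a b)
    (hbc : proj κ b = proj κ c) : ∃ d, proj κ a = proj κ d ∧ θ d c := by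
  obtain ⟨a', ha'⟩ := exists_isGroupInverse a
  obtain ⟨b', hb'⟩ := exists_isGroupInverse b
  obtain ⟨y, hy⟩ := exists_isGroupInverse (b * a)
  obtain ⟨z, hz⟩ := exists_isGroupInverse (b * b)
  -- a Mal'cev term in `a`, `b`, `c`
  refine ⟨a * a * y * c * (a * a'), ?_, ?_⟩
  -- m(a,b,b) = a; κ identifies `b` with `c`, so the witness is κ-related to `a`.
  · have h : a * a * y * b * (a * a') = a := by
      calc a * a * y * b * (a * a') = a * (a * (y * (b * a))) * a' := by simp only [mul_assoc]
        _ = a * a' * a := by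
          rw [← hy.comm, mul_mul_groupInverse hy, mul_assoc, ha'.comm, ← mul_assoc, ha'.comm]
        _ = a := ha'.mul_mul
    conv_lhs => rw [← h]
    simp only [map_mul, hbc]
  · have hends := proj_eq_of_le hκ hbc
    have hbz : b * b * z = b * b' := by
      have h1 := mul_mul_groupInverse hz
      calc b * b * z = b' * b * b * b * z := by rw [← hb'.comm, hb'.mul_mul]
        _ = b' * (b * (b * b * z)) := by simp only [mul_assoc]
        _ = b * b' := by rw [h1, hb'.comm]
    -- m(b,b,c) = c: `b * b'` is a two-sided identity for `c`, which shares its end letters with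
    -- `b`.
    have h : b * b * z * c * (b * b') = c := by
      rw [hbz, mul_groupInverse_mul_of_ends hb' hends, mul_mul_groupInverse_of_ends hb' hends]
    let q : FreePro CS A →ₙ* θ.Quotient := θ.quotientHom
    have qab : q a = q b := θ.quotientHom_eq.2 hab
    have qa' : q a' = q b' := (qab ▸ ha'.map q : IsGroupInverse (q b) (q a')).unique (hb'.map q)
    have qy : q y = q z := by
      have h1 := hy.map q
      have h2 := hz.map q
      rw [map_mul] at h1 h2
      rw [qab] at h1
      exact h1.unique h2
    refine θ.quotientHom_eq.1 ?_
    change q _ = q _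
    conv_rhs => rw [← h]
    simp only [map_mul, qab, qa', qy]

/-- The product of a congruence with the kernel of a projection that determines the first and the
last letter. -/
def conComp (θ : Con (FreePro CS A)) (κ : CS.Quot A) (hκ : κ.1 ≤ (endsQuot A).1) :
    Con (FreePro CS A) where
  r x y := ∃ z, θ x z ∧ proj κ z = proj κ y
  iseqv := by
    refine ⟨fun x => ⟨x, θ.refl x, rfl⟩, ?_, ?_⟩
    · rintro x y ⟨z, hxz, hzy⟩
      -- From x θ z κ y, permuting gives x κ d θ y, which read backwards is the claim.
      obtain ⟨d, hd, hdy⟩ := exists_proj_eq_of_con θ hκ hxz hzy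
      exact ⟨d, θ.symm hdy, hd.symm⟩
    · rintro x y w ⟨z, hxz, hzy⟩ ⟨z', hyz', hzw⟩
      -- In x θ z κ y θ z' κ w the middle pair is exchanged, giving x θ z θ d κ z' κ w.
      obtain ⟨d, hd, hdz⟩ := exists_proj_eq_of_con θ hκ (θ.symm hyz') hzy.symm
      exact ⟨d, θ.trans hxz (θ.symm hdz), hd.symm.trans hzw⟩
  mul' := by
    rintro w x y z ⟨p, hp, hp'⟩ ⟨q, hq, hq'⟩
    exact ⟨p * q, θ.mul hp hq, by rw [map_mul, map_mul, hp', hq']⟩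

end FreePro

/-- A finite quotient of a free pro-`U` semigroup in which the provable equalities hold is a
model. -/
theorem isModel_quotient {U : SemigroupPseudovariety} {Γ : Set (Pseudoidentity U)} {A : Type}
    [Nonempty A] {ρ : Con (FreePro U A)} (hU : U.Mem ρ.Quotient)
    (hρ : Continuous[_, ⊥] ρ.quotientHom) (hΓ : provableCon Γ A ≤ ρ) :
    IsModel Γ ρ.Quotient := by
  refine ⟨hU, fun e he φ hφ => ?_⟩
  have := e.nonempty
  -- Lifting the images of the letters makes φ factor through a continuous ψ into the free pro-`U`
  -- semigroup, where the instance of `e` under ψ is provable.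
  choose x hx using fun b : e.Alphabet => Quotient.exists_rep (φ (FreePro.of b))
  obtain ⟨ψ, hψ, hψx⟩ := FreePro.exists_extension x
  have hcont : Continuous[_, ⊥] (ρ.quotientHom.comp ψ) := @Continuous.comp _ _ _ _ _ ⊥ ψ ρ.quotientHom hρ hψ
  have heq : φ = ρ.quotientHom.comp ψ := (FreePro.existsUnique_extension hU fun b => φ (.of b)).unique
    ⟨hφ, fun _ => rfl⟩ ⟨hcont, fun b => by rw [MulHom.comp_apply, hψx]; exact hx b⟩
  rw [heq]
  exact (Con.eq ρ).2 (hΓ (provableCon_hom he ψ hψ))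

theorem theoremt : CS.IsStrong := by
  intro Γ e h
  have := e.finite
  have := e.nonempty
  by_contra hne
  let A := e.Alphabet
  let θ := provableCon Γ A
  have hV : {y : FreePro CS A | (e.lhs, y) ∉ provablePairs Γ A} ∈ 𝓝 e.rhs :=
    ((isClosed_provablePairs Γ A).isOpen_compl.preimage
      (Continuous.prodMk_right e.lhs)).mem_nhds hne
  obtain ⟨c, hc⟩ := FreePro.exists_proj_class_subset hV
  -- Refining `c` keeps the separation and adds the knowledge of end letters that permutability
  -- needs.
  obtain ⟨κ, hκc, hκ⟩ := FreePro.exists_le_le c (FreePro.endsQuot A)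
  let ρ := FreePro.conComp θ κ hκ
  have hκρ : ∀ x y, FreePro.proj κ x = FreePro.proj κ y → ρ x y :=
    fun x y hxy => ⟨x, θ.refl x, hxy⟩
  have hcont : Continuous[_, ⊥] ρ.quotientHom :=
    FreePro.continuous_discrete_of_proj κ _ fun x y hxy => (Con.eq ρ).2 (hκρ x y hxy)
  have hmodel : IsModel Γ ρ.Quotient :=
    isModel_quotient (FreePro.mem_CS_quotient_of_proj hκρ) hcont fun {_ y} hxy => ⟨y, hxy, rfl⟩
  obtain ⟨z, hz, hz'⟩ : ρ e.lhs e.rhs :=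
    (Con.eq ρ).1 (h ρ.Quotient hmodel ρ.quotientHom hcont)
  exact hc z (FreePro.proj_eq_of_le hκc hz') hz
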